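/- Let $R$ be an associative ring with unity and let $\mathcal{X}$ be a class of $R$-modules closed under arbitrary direct sums, direct summands (hence under isomorphism) and extensions. Let $C(\mathcal{X}^*)$ be the class of all (unbounded) complexes $\cdots\to C^{n-1}\to C^{n}\to C^{n+1}\to\cdots$ of $R$-modules with $C^n\in\mathcal{X}$ for every $n\in\mathbb{Z}$, and suppose that $C(\mathcal{X}^*)$ is closed under inverse limits and direct limits, that is, limits of inverse systems and colimits of direct systems of complexes indexed by nonempty directed partially ordered sets. If every $R$-module has an $\mathcal{X}$-envelope, then every complex of $R$-modules has a $C(\mathcal{X}^*)$-envelope. Here, for a class $\mathcal{Y}$ of objects of an abelian category, a $\mathcal{Y}$-envelope of an object $M$ is a morphism $\phi: M\to X$ with $X\in\mathcal{Y}$ such that every morphism $f: M\to X'$ with $X'\in\mathcal{Y}$ factors as $f=g\phi$ for some $g: X\to X'$, and such that every endomorphism $g$ of $X$ with $g\phi=\phi$ is an automorphism of $X$. -/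

import Mathlib

open CategoryTheory

universe w v u

/-- `φ : M ⟶ X` is a `Y`-preenvelope of `M`: `X` belongs to `Y`, and every morphism from `M` to
an object of `Y` factors through `φ`. -/
structure IsPreenvelope {A : Type u} [Category.{v} A] (Y : ObjectProperty A) {M X : A}
    (φ : M ⟶ X) : Prop where
  mem : Y X
  exists_fac : ∀ ⦃X' : A⦄, Y X' → ∀ f : M ⟶ X', ∃ g : X ⟶ X', φ ≫ g = f

/-- `φ : M ⟶ X` is a `Y`-envelope of `M`: a `Y`-preenvelope such that every endomorphism `g`
of `X` with `φ ≫ g = φ` is an automorphism. -/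
structure IsEnvelope {A : Type u} [Category.{v} A] (Y : ObjectProperty A) {M X : A}
    (φ : M ⟶ X) : Prop extends IsPreenvelope Y φ where
  isIso_of_fac : ∀ g : X ⟶ X, φ ≫ g = φ → IsIso g

/-- Every object of the category has a `Y`-envelope. -/
def HasEnvelopes {A : Type u} [Category.{v} A] (Y : ObjectProperty A) : Prop :=
  ∀ M : A, ∃ (X : A) (φ : M ⟶ X), IsEnvelope Y φ

/-- `Y` is closed under direct sums of families indexed by arbitrary types of size `w`. -/
def ClosedUnderDirectSums {A : Type u} [Category.{v} A] (Y : ObjectProperty A) : Prop :=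
  ∀ ι : Type w, Y.IsClosedUnderColimitsOfShape (Discrete ι)

/-- `Y` is closed under direct limits: colimits of direct systems indexed by nonempty
directed posets. -/
def ClosedUnderDirectLimits {A : Type u} [Category.{v} A] (Y : ObjectProperty A) : Prop :=
  ∀ (I : Type w) [PartialOrder I] [IsDirectedOrder I] [Nonempty I],
    Y.IsClosedUnderColimitsOfShape I

/-- `Y` is closed under inverse limits: limits of inverse systems indexed by nonempty
directed posets. -/
def ClosedUnderInverseLimits {A : Type u} [Category.{v} A] (Y : ObjectProperty A) : Prop :=
  ∀ (I : Type w) [PartialOrder I] [IsDirectedOrder I] [Nonempty I],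
    Y.IsClosedUnderLimitsOfShape Iᵒᵖ

/-- The class `C(𝒳*)` of (unbounded) complexes of modules all of whose terms lie in `𝒳`. -/
def complexesIn {R : Type u} [Ring R] (𝒳 : ObjectProperty (ModuleCat.{v} R)) :
    ObjectProperty (CochainComplex (ModuleCat.{v} R) ℤ) :=
  fun K => ∀ n : ℤ, 𝒳 (K.X n)

open Limits

/-! Closure under kernels makes every envelope `φ` a reflection: two factorizations through `φ`
agree on a kernel in `𝒳` through which `φ` factors. Uniqueness then lets envelopes be applied
degreewise. For kernels, let `f : A → B` and let `S` be infinite. The pairs in `A × B^(S)` with `b s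
= f a` on a finite `T ⊆ S` form a direct summand. Their intersection over all `T` is `ker f`, since
a constant family of finite support vanishes; it is a directed inverse limit. -/

section Intersection

variable {R : Type u} [Ring R] {M : Type v} [AddCommGroup M] [Module R M]
  {I : Type w} [Preorder I]

/-- The inverse system of submodules attached to an antitone family. -/
def submoduleInverseSystem (N : I → Submodule R M) (hN : Antitone N) :
    Iᵒᵖ ⥤ ModuleCat.{v} R where
  obj i := ModuleCat.of R (N i.unop)
  map f := ModuleCat.ofHom (Submodule.inclusion (hN f.unop.le))

/-- The intersection of an antitone family of submodules, as a cone over the family. -/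
def iInfCone (N : I → Submodule R M) (hN : Antitone N) :
    Cone (submoduleInverseSystem N hN) where
  pt := ModuleCat.of R (⨅ i, N i : Submodule R M)
  π := { app := fun i => ModuleCat.ofHom (Submodule.inclusion (iInf_le N i.unop)) }

/-- Directedness lets both components be compared with one at a common upper bound. -/
lemma cone_submodule_coe_eq {N : I → Submodule R M} {hN : Antitone N} [IsDirectedOrder I]
    (s : Cone (submoduleInverseSystem N hN)) (i j : I) (x : s.pt) :
    ((s.π.app (.op i)).hom x : N i).1 = ((s.π.app (.op j)).hom x : N j).1 := by
  obtain ⟨k, hik, hjk⟩ := exists_ge_ge i j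
  have aux : ∀ l (h : l ≤ k),
      ((s.π.app (.op l)).hom x : N l).1 = ((s.π.app (.op k)).hom x : N k).1 := by
    intro l h
    rw [← s.w (homOfLE h).op]
    rfl
  rw [aux i hik, aux j hjk]

/-- The intersection of a directed family of submodules is its inverse limit. -/
noncomputable def iInfConeIsLimit (N : I → Submodule R M) (hN : Antitone N)
    [IsDirectedOrder I] [Nonempty I] : IsLimit (iInfCone N hN) where
  lift s := ModuleCat.ofHom (LinearMap.codRestrict _
    ((N (Classical.arbitrary I)).subtype ∘ₗ (s.π.app (.op (Classical.arbitrary I))).hom)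
    (fun x => by
      rw [Submodule.mem_iInf]
      intro j
      change ((s.π.app (.op (Classical.arbitrary I))).hom x : N (Classical.arbitrary I)).1 ∈ N j
      rw [cone_submodule_coe_eq s (Classical.arbitrary I) j x]
      exact ((s.π.app (.op j)).hom x : N j).2))
  fac s j := by
    ext x
    exact Subtype.ext (cone_submodule_coe_eq s (Classical.arbitrary I) j.unop x)
  uniq s m h := by
    ext x
    apply Subtype.ext
    exact congr((($(h (.op (Classical.arbitrary I)))).hom x : N (Classical.arbitrary I)).1)

end Intersection

section EventuallyConstant

variable {R : Type u} [Ring R] {A B : Type v} [AddCommGroup A] [Module R A]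
  [AddCommGroup B] [Module R B] {S : Type w}

/-- The pairs `(a, b)` in `A × B^(S)` with `b s = f a` for all `s ∈ T`. -/
def agreeOn (f : A →ₗ[R] B) (T : Finset S) : Submodule R (A × (S →₀ B)) where
  carrier := {p | ∀ s ∈ T, p.2 s = f p.1}
  add_mem' hp hq s hs := by simp [hp s hs, hq s hs]
  zero_mem' s _ := by simp
  smul_mem' r p hp s hs := by simp [hp s hs]

lemma agreeOn_antitone (f : A →ₗ[R] B) : Antitone (agreeOn (S := S) f) :=
  fun _ _ h _ hp s hs => hp s (h hs)

open Classical in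
/-- The endomorphism of `A × B^(S)` replacing the coordinates of `b` in `T` by `f a`. -/
noncomputable def forceAgree (f : A →ₗ[R] B) (T : Finset S) :
    A × (S →₀ B) →ₗ[R] A × (S →₀ B) :=
  (LinearMap.fst R A (S →₀ B)).prod
    ((∑ t ∈ T, Finsupp.lsingle t ∘ₗ f) ∘ₗ LinearMap.fst R A (S →₀ B) +
      (LinearMap.id - ∑ t ∈ T, Finsupp.lsingle t ∘ₗ Finsupp.lapply t) ∘ₗ
        LinearMap.snd R A (S →₀ B))

lemma forceAgree_mem (f : A →ₗ[R] B) (T : Finset S) (p : A × (S →₀ B)) :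
    forceAgree f T p ∈ agreeOn f T := by
  classical
  intro s hs
  simp [forceAgree, LinearMap.sum_apply, Finsupp.single_apply, hs]

/-- With `forceAgree_mem`, this makes `forceAgree f T` an idempotent with image `agreeOn f T`, hence
the latter a direct summand. -/
lemma forceAgree_eq_self {f : A →ₗ[R] B} {T : Finset S} {p : A × (S →₀ B)}
    (hp : p ∈ agreeOn f T) : forceAgree f T p = p := by
  classical
  refine Prod.ext rfl ?_
  ext s
  by_cases hs : s ∈ T
  · exact (forceAgree_mem f T p s hs).trans (hp s hs).symm
  · simp [forceAgree, LinearMap.sum_apply, Finsupp.single_apply, hs]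

/-- The projection of `A × B^(S)` onto `agreeOn f T`. -/
noncomputable def agreeOnProj (f : A →ₗ[R] B) (T : Finset S) :
    A × (S →₀ B) →ₗ[R] agreeOn f T :=
  LinearMap.codRestrict _ (forceAgree f T) (forceAgree_mem f T)

lemma agreeOnProj_coe (f : A →ₗ[R] B) (T : Finset S) (p : agreeOn f T) :
    agreeOnProj f T p = p :=
  Subtype.ext (forceAgree_eq_self p.2)

/-- The intersection of all the `agreeOn f T` is the kernel of `f`. -/
noncomputable def iInfAgreeOnEquivKer [Infinite S] (f : A →ₗ[R] B) :
    (⨅ T, agreeOn (S := S) f T : Submodule R (A × (S →₀ B))) ≃ₗ[R] LinearMap.ker f := by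
  have key : ∀ p ∈ (⨅ T, agreeOn (S := S) f T : Submodule R (A × (S →₀ B))),
      (∀ s, p.2 s = f p.1) ∧ f p.1 = 0 := by
    intro p hp
    rw [Submodule.mem_iInf] at hp
    have h : ∀ s, p.2 s = f p.1 := fun s => hp {s} s (by simp)
    obtain ⟨s, hs⟩ := Infinite.exists_notMem_finset p.2.support
    exact ⟨h, by rw [← h s, Finsupp.notMem_support_iff.1 hs]⟩
  refine LinearEquiv.ofLinearMap
    (LinearMap.codRestrict _ (LinearMap.fst R A (S →₀ B) ∘ₗ Submodule.subtype _)
      fun p => (key p.1 p.2).2)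
    (LinearMap.codRestrict _ (LinearMap.inl R A (S →₀ B) ∘ₗ Submodule.subtype _)
      fun a => (Submodule.mem_iInf _).2 fun T s _ => by simp) ?_ ?_
  · ext; rfl
  · ext p : 1
    apply Subtype.ext
    refine Prod.ext rfl ?_
    ext s
    have := key p.1 p.2
    simp [this.1 s, this.2]

end EventuallyConstant

section Closure

variable {R : Type u} [Ring R] {𝒳 : ObjectProperty (ModuleCat.{v} R)}

lemma ClosedUnderDirectSums.finsupp_mem [𝒳.IsClosedUnderIsomorphisms]
    (h : ClosedUnderDirectSums.{v} 𝒳) (S : Type v) {B : ModuleCat.{v} R} (hB : 𝒳 B) :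
    𝒳 (ModuleCat.of R (S →₀ B)) := by
  classical
  have := h S
  exact 𝒳.prop_of_iso (finsuppLEquivDirectSum R B S).symm.toModuleIso
    (𝒳.prop_of_isColimit (ModuleCat.coproductCoconeIsColimit.{u, v, v} (fun _ : S => B))
      (fun _ => hB))

lemma ClosedUnderDirectSums.prod_mem [𝒳.IsClosedUnderIsomorphisms]
    (h : ClosedUnderDirectSums.{v} 𝒳) {A B : ModuleCat.{v} R} (hA : 𝒳 A) (hB : 𝒳 B) :
    𝒳 (ModuleCat.of R (A × B)) := by
  have := h (ULift WalkingPair)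
  have := ObjectProperty.IsClosedUnderColimitsOfShape.of_equivalence (P := 𝒳)
    (Discrete.equivalence (Equiv.ulift : ULift.{v} WalkingPair ≃ WalkingPair))
  exact 𝒳.prop_of_iso (ModuleCat.biprodIsoProd A B)
    (𝒳.prop_of_isColimit (BinaryBiproduct.isColimit A B) (by rintro ⟨_ | _⟩ <;> assumption))

/-- Zero is the empty direct sum. -/
lemma ClosedUnderDirectSums.zero_mem [𝒳.IsClosedUnderIsomorphisms]
    (h : ClosedUnderDirectSums.{v} 𝒳) {Z : ModuleCat.{v} R} (hZ : IsZero Z) : 𝒳 Z := by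
  have := h PEmpty
  refine 𝒳.prop_of_isColimit (F := Discrete.functor PEmpty.elim) (c := Cofan.mk Z (by rintro ⟨⟩))
    { desc := fun s => hZ.to_ _
      fac := by rintro _ ⟨⟨⟩⟩
      uniq := fun _ _ _ => hZ.eq_of_src _ _ } (by rintro ⟨⟨⟩⟩)

lemma complexesIn_single_obj [𝒳.IsClosedUnderIsomorphisms]
    (h : ClosedUnderDirectSums.{v} 𝒳) (n : ℤ) {A : ModuleCat.{v} R} (hA : 𝒳 A) :
    complexesIn 𝒳 ((HomologicalComplex.single _ (ComplexShape.up ℤ) n).obj A) := by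
  intro m
  by_cases hm : m = n
  · subst hm
    exact 𝒳.prop_of_iso (HomologicalComplex.singleObjXSelf _ m A).symm hA
  · exact h.zero_mem (HomologicalComplex.isZero_single_obj_X _ _ _ _ hm)

/-- A system of modules is placed in degree 0; the functor `single` preserves its limit. -/
lemma ClosedUnderInverseLimits.of_complexesIn [𝒳.IsClosedUnderIsomorphisms]
    (h : ClosedUnderDirectSums.{v} 𝒳) (hinv : ClosedUnderInverseLimits.{v} (complexesIn 𝒳)) :
    ClosedUnderInverseLimits.{v} 𝒳 := by
  intro I _ _ _
  have := hinv I
  refine ⟨fun X ⟨p⟩ => ?_⟩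
  have hlim := isLimitOfPreserves (HomologicalComplex.single _ (ComplexShape.up ℤ) 0) p.isLimit
  exact 𝒳.prop_of_iso (HomologicalComplex.singleObjXSelf _ 0 X)
    ((complexesIn 𝒳).prop_of_isLimit hlim
      (fun j => complexesIn_single_obj h 0 (p.prop_diag_obj j)) 0)

/-- A class of modules closed under direct sums, direct summands and directed inverse limits
is closed under kernels. -/
lemma ker_mem_of_closedUnderInverseLimits [𝒳.IsStableUnderRetracts]
    (h : ClosedUnderDirectSums.{v} 𝒳) (hinv : ClosedUnderInverseLimits.{v} 𝒳)
    {A B : ModuleCat.{v} R} (f : A ⟶ B) (hA : 𝒳 A) (hB : 𝒳 B) :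
    𝒳 (ModuleCat.of R (LinearMap.ker f.hom)) := by
  classical
  have hS := h.prod_mem hA (h.finsupp_mem (ULift.{v} ℕ) hB)
  -- Any infinite index set would do; `ULift` places `ℕ` in universe `v`.
  have := hinv (Finset (ULift.{v} ℕ))
  refine 𝒳.prop_of_iso (iInfAgreeOnEquivKer (S := ULift.{v} ℕ) f.hom).toModuleIso
    (𝒳.prop_of_isLimit (iInfConeIsLimit _ (agreeOn_antitone f.hom)) fun T => ?_)
  refine 𝒳.prop_of_retract
    { i := ModuleCat.ofHom (agreeOn f.hom T.unop).subtype
      r := ModuleCat.ofHom (agreeOnProj f.hom T.unop)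
      retract := ?_ } hS
  ext p
  exact agreeOnProj_coe f.hom T.unop p

end Closure

section Reflection

variable {R : Type u} [Ring R] {𝒳 : ObjectProperty (ModuleCat.{v} R)}

/-- If the class is closed under kernels, factorizations through an envelope are unique. -/
lemma IsEnvelope.hom_ext
    (hker : ∀ {A B : ModuleCat.{v} R} (f : A ⟶ B), 𝒳 A → 𝒳 B →
      𝒳 (ModuleCat.of R (LinearMap.ker f.hom)))
    {M X Y : ModuleCat.{v} R} {φ : M ⟶ X} (hφ : IsEnvelope 𝒳 φ) (hY : 𝒳 Y) {g h : X ⟶ Y}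
    (w : φ ≫ g = φ ≫ h) : g = h := by
  have hw : φ ≫ (g - h) = 0 := by rw [Preadditive.comp_sub, w, sub_self]
  let i : ModuleCat.of R (LinearMap.ker (g - h).hom) ⟶ X :=
    ModuleCat.ofHom (LinearMap.ker (g - h).hom).subtype
  have hi : i ≫ (g - h) = 0 := by
    ext x
    exact x.2
  let ψ : M ⟶ ModuleCat.of R (LinearMap.ker (g - h).hom) :=
    ModuleCat.ofHom (LinearMap.codRestrict _ φ.hom fun x => congr($hw x))
  have hψ : ψ ≫ i = φ := rfl
  obtain ⟨p, hp⟩ := hφ.exists_fac (hker (g - h) hφ.mem hY) ψ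
  -- This endomorphism fixes `φ`, so it is invertible, yet `g - h` kills it.
  have := hφ.isIso_of_fac (p ≫ i) (by rw [reassoc_of% hp, hψ])
  rw [← sub_eq_zero, ← cancel_epi (p ≫ i), Category.assoc, hi, comp_zero, comp_zero]

/-- If envelopes of modules exist and have unique factorizations, then applying them degreewise
yields envelopes of complexes. -/
lemma hasEnvelopes_complexesIn (henv : HasEnvelopes 𝒳)
    (huniq : ∀ {M X Y : ModuleCat.{v} R} {φ : M ⟶ X}, IsEnvelope 𝒳 φ → 𝒳 Y →
      ∀ {g h : X ⟶ Y}, φ ≫ g = φ ≫ h → g = h) :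
    HasEnvelopes (complexesIn 𝒳) := by
  intro K
  choose L φ hφ using henv
  choose d hd using fun i j => (hφ (K.X i)).exists_fac (hφ (K.X j)).mem (K.d i j ≫ φ (K.X j))
  let LK : CochainComplex (ModuleCat.{v} R) ℤ :=
    { X := fun i => L (K.X i)
      d := d
      shape := fun i j hij => huniq (hφ _) (hφ _).mem (by
        rw [hd, K.shape i j hij, zero_comp, comp_zero])
      d_comp_d' := fun i j k _ _ => huniq (hφ _) (hφ _).mem (by
        rw [reassoc_of% (hd i j), hd, K.d_comp_d_assoc, zero_comp, comp_zero]) }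
  let η : K ⟶ LK := { f := fun i => φ (K.X i), comm' := fun i j _ => hd i j }
  refine ⟨LK, η, ⟨fun i => (hφ _).mem, fun Y hY f => ?_⟩, fun g hg => ?_⟩
  · choose g hg using fun i => (hφ (K.X i)).exists_fac (hY i) (f.f i)
    refine ⟨{ f := g, comm' := fun i j _ => huniq (hφ _) (hY j) ?_ }, ?_⟩
    · change φ _ ≫ g i ≫ Y.d i j = φ _ ≫ d i j ≫ g j
      rw [reassoc_of% (hg i), reassoc_of% (hd i j), hg, f.comm]
    · ext1 i
      exact hg i
  · have : g = 𝟙 LK := by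
      ext1 i
      refine huniq (hφ (K.X i)) (hφ _).mem ?_
      have h : φ (K.X i) ≫ g.f i = φ (K.X i) := congr(HomologicalComplex.Hom.f $hg i)
      exact h.trans (Category.comp_id _).symm
    rw [this]
    infer_instance

end Reflection

theorem theorem2p10 {R : Type u} [Ring R] (𝒳 : ObjectProperty (ModuleCat.{v} R))
    (hsum : ClosedUnderDirectSums.{v} 𝒳)
    (hsummand : 𝒳.IsStableUnderRetracts)
    (hext : 𝒳.IsClosedUnderExtensions)
    (hinv : ClosedUnderInverseLimits.{v} (complexesIn 𝒳))
    (hdir : ClosedUnderDirectLimits.{v} (complexesIn 𝒳))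
    (henv : HasEnvelopes 𝒳) :
    HasEnvelopes (complexesIn 𝒳) :=
  hasEnvelopes_complexesIn henv fun hφ hY => hφ.hom_ext
    (ker_mem_of_closedUnderInverseLimits hsum (.of_complexesIn hsum hinv)) hY
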